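/- A finite set $S$ of closed intervals $[a,b]$ ($a\le b$) of the real line, initially empty, undergoes a sequence of updates, each of which inserts an interval into $S$ or deletes an interval from $S$; $n$ denotes the current number of intervals (for bounds on the cost of an update, the number right after it). A coloring of $S$ by natural numbers is conflict-free if every point $q\in\mathbb{R}$ that lies in some interval of $S$ lies in an interval of $S$ whose color is unique among the intervals of $S$ containing $q$. A strategy assigns a coloring of the current set after each update, depending only on the updates so far; it maintains a conflict-free coloring if all these colorings are conflict-free. The coloring uses at most $m$ colors if its colors come from $\{0,\dots,k-1\}$ for some integer $k\le m$. The number of recolorings of an update is the number of intervals, present both before and after it, whose color changes. Then the following hold. (i) There is an absolute constant $C$ such that for every real $t\ge 2$ there is a strategy that maintains a conflict-free coloring, uses at every moment at most $C\max(1,\log_t n)$ colors, and performs at most $C\,t\max(1,\log_t n)$ recolorings at each insertion and each deletion; that is, $O(\log_t n)$ colors and $O(t\log_t n)$ recolorings. In particular, there are a constant $C$ and a strategy that maintains a conflict-free coloring with at most $C\max(1,\log n)$ colors and at most $C\max(1,\log n)$ recolorings per update; that is, $O(\log n)$ colors and $O(\log n)$ recolorings. (Here $\log 0$ is read as $0$.)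 (ii) There is an absolute constant $C$ such that for every $\varepsilon>0$ there is a strategy that maintains a conflict-free coloring, uses at every moment at most $C\max(1,1/\varepsilon)$ colors, and performs amortized at most $C\,n^{\varepsilon}/\varepsilon$ recolorings per update: for every sequence of updates starting from the empty set, the total number of recolorings is at most $\sum_i C\,n_i^{\varepsilon}/\varepsilon$, where $n_i$ is the number of intervals right after the $i$-th update. That is, it uses $O(1/\varepsilon)$ colors and $O(n^{\varepsilon}/\varepsilon)$ amortized recolorings. -/

import Mathlib

/-- An update of a dynamic set of closed intervals `[a, b]`, `a ≤ b`, of the real line. -/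
inductive IntervalUpdate where
  | insert (I : NonemptyInterval ℝ)
  | delete (I : NonemptyInterval ℝ)

/-- The set of intervals after an update of the set `S`. -/
noncomputable def IntervalUpdate.apply (S : Finset (NonemptyInterval ℝ)) :
    IntervalUpdate → Finset (NonemptyInterval ℝ)
  | .insert I => Insert.insert I S
  | .delete I => S.erase I

/-- A history: the finite sequence of the updates performed so far, the latest one first. -/
abbrev UpdateHistory := List IntervalUpdate

/-- The current set of intervals after a history; it is empty at the start. -/
noncomputable def currentSet : UpdateHistory → Finset (NonemptyInterval ℝ)
  | [] => ∅
  | u :: h => u.apply (currentSet h)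

/-- A coloring `c` of the finite set `S` of intervals is conflict-free (with respect to points)
if every point `q` that lies in some interval of `S` lies in an interval of `S` whose color is
unique among the intervals of `S` that contain `q`. -/
def IsConflictFree (S : Finset (NonemptyInterval ℝ)) (c : NonemptyInterval ℝ → ℕ) : Prop :=
  ∀ q : ℝ, (∃ I ∈ S, q ∈ I) →
    ∃ I ∈ S, q ∈ I ∧ ∀ J ∈ S, q ∈ J → c J = c I → J = I

/-- The colors of the intervals of `S` belong to the palette `{0, 1, …, k - 1}` for a natural
number `k` with `k ≤ m`. -/
def UsesAtMostColors (S : Finset (NonemptyInterval ℝ)) (c : NonemptyInterval ℝ → ℕ) (m : ℝ) :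
    Prop :=
  ∃ k : ℕ, (k : ℝ) ≤ m ∧ ∀ I ∈ S, c I < k

/-- A (deterministic, online) coloring strategy: after each history it provides a coloring, which
can depend on the updates so far but not on future ones. Only the colors of the intervals of the
current set matter. -/
abbrev ColoringStrategy := UpdateHistory → NonemptyInterval ℝ → ℕ

namespace ColoringStrategy

/-- The strategy keeps the coloring of the current set conflict-free at all times. -/
def MaintainsConflictFree (A : ColoringStrategy) : Prop :=
  ∀ h : UpdateHistory, IsConflictFree (currentSet h) (A h)

/-- The number of recolorings that the strategy performs at the update `u` after the history `h`:
the number of intervals present before and after the update whose color changes. -/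
noncomputable def recolorings (A : ColoringStrategy) (h : UpdateHistory) (u : IntervalUpdate) :
    ℕ :=
  ((currentSet h ∩ currentSet (u :: h)).filter fun I => A h I ≠ A (u :: h) I).card

/-- The total number of recolorings over a history. -/
noncomputable def totalRecolorings (A : ColoringStrategy) : UpdateHistory → ℕ
  | [] => 0
  | u :: h => A.totalRecolorings h + A.recolorings h u

/-- At every moment the strategy uses at most `f n` colors, where `n` is the current number of
intervals. -/
def ColorsBoundedBy (A : ColoringStrategy) (f : ℕ → ℝ) : Prop :=
  ∀ h : UpdateHistory, UsesAtMostColors (currentSet h) (A h) (f (currentSet h).card)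

/-- Every single update performs at most `f n` recolorings (worst case), where `n` is the number
of intervals right after the update. -/
def RecoloringsBoundedBy (A : ColoringStrategy) (f : ℕ → ℝ) : Prop :=
  ∀ (h : UpdateHistory) (u : IntervalUpdate),
    (A.recolorings h u : ℝ) ≤ f (currentSet (u :: h)).card

end ColoringStrategy

/-- The sum of `f n` over all updates of a history, where `n` is the number of intervals right
after the update. -/
noncomputable def sumOverUpdates (f : ℕ → ℝ) : UpdateHistory → ℝ
  | [] => 0
  | u :: h => sumOverUpdates f h + f (currentSet (u :: h)).card

/-- The strategy performs amortized at most `f n` recolorings per update, where `n` is the current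
number of intervals: over every sequence of updates, starting from the empty set, the total number
of recolorings is at most the sum of the bounds `f n` of the individual updates. -/
def ColoringStrategy.AmortizedRecoloringsBoundedBy (A : ColoringStrategy) (f : ℕ → ℝ) : Prop :=
  ∀ h : UpdateHistory, (A.totalRecolorings h : ℝ) ≤ sumOverUpdates f h

/-! A static family needs three colors. A minimal subcover of its union can be 2-colored so that
equal colors are disjoint, and all other intervals receive the dummy color 0. Redoing this after
each update is too expensive, so the family is cut into small independent pieces by a hierarchy of
separators (`IsSeparatorChain`). Level 0 is the set of left endpoints. Level `ℓ` has at most `n / t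
^ ℓ` points, and at most `6 * t` of them lie in any interval avoiding level `ℓ + 1`. An interval has
level `ℓ` if it meets level `ℓ` but not level `ℓ + 1`, and the intervals of level `ℓ` in one gap of
level `ℓ + 1` form a group. Groups of the same level are disjoint, so they share two proper colors,
and different levels use different pairs. This gives a conflict-free coloring with two colors per
level and `O(log_t n)` levels.

An update changes at most two separators per level: a new endpoint may enter every level, and a
counting argument (`exists_removable_separator`) finds a superfluous point to discard. A color can
change only in the `O(1)` gaps per level that are next to a change (`chainColor_eq`). In a gap the
properly colored intervals number `O(t)`, since each contains one of the `O(t)` points of level `ℓ`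
there and equal colors are disjoint (`card_le_of_pairwise`). A recolored interval has a proper color
before or after the update, which yields `O(t log_t n)` recolorings.

For the amortized bound with `ε ≤ 1`, take `t` about `n ^ ε`, so that `O(1 / ε)` levels suffice, and
rebuild whenever `n` leaves a factor-two window around the size for which `t` was chosen. For `ε ≥
1` the static coloring is recomputed at each update. -/

/-! ### Intervals, their hulls, and meeting a finite point set -/

/-- The interval `I` contains a point of the finite set `F`. -/
def Hits (I : NonemptyInterval ℝ) (F : Finset ℝ) : Prop := ∃ p ∈ F, p ∈ I

theorem Hits.mono {I J : NonemptyInterval ℝ} {F : Finset ℝ} (h : Hits I F) (hIJ : I ≤ J) :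
    Hits J F := by
  obtain ⟨p, hp, hpI⟩ := h
  exact ⟨p, hp, (NonemptyInterval.coe_subset_coe.2 hIJ) hpI⟩

theorem Hits.mono_right {I : NonemptyInterval ℝ} {F F' : Finset ℝ} (h : Hits I F) (hF : F ⊆ F') :
    Hits I F' := by
  obtain ⟨p, hp, hpI⟩ := h
  exact ⟨p, hF hp, hpI⟩

theorem mem_interval {I : NonemptyInterval ℝ} {x : ℝ} : x ∈ I ↔ I.fst ≤ x ∧ x ≤ I.snd :=
  Iff.rfl

theorem mem_sup_interval {I J : NonemptyInterval ℝ} {x : ℝ} :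
    x ∈ I ⊔ J ↔ (I.fst ≤ x ∨ J.fst ≤ x) ∧ (x ≤ I.snd ∨ x ≤ J.snd) := by
  rw [mem_interval, NonemptyInterval.fst_sup, NonemptyInterval.snd_sup]
  simp

/-- Since `⊔` is the convex hull, `I ⊔ pure d` is `I` stretched to reach `d`. A separator in it that
avoids `I` and differs from `d` lies strictly between `I` and `d`; this is how distance from a
change is expressed below. -/
theorem mem_sup_pure {I : NonemptyInterval ℝ} {x d : ℝ} :
    x ∈ I ⊔ NonemptyInterval.pure d ↔ (I.fst ≤ x ∨ d ≤ x) ∧ (x ≤ I.snd ∨ x ≤ d) :=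
  mem_sup_interval

theorem sup_pure_le {I J : NonemptyInterval ℝ} {x : ℝ} (hx : x ∈ J) :
    I ⊔ NonemptyInterval.pure x ≤ I ⊔ J := by
  rw [← NonemptyInterval.coe_subset_coe]
  intro y hy
  have hx' := mem_interval.1 hx
  have hy' := mem_sup_pure.1 hy
  refine mem_sup_interval.2 ⟨?_, ?_⟩
  · exact hy'.1.imp_right (fun h => hx'.1.trans h)
  · exact hy'.2.imp_right (fun h => h.trans hx'.2)

/-! ### Coloring a fixed finite family -/

/-- A minimal subfamily with the same union: each of its members has a private point. -/
theorem exists_cover_with_private_points (G : Finset (NonemptyInterval ℝ)) :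
    ∃ M ⊆ G, (∀ q : ℝ, (∃ I ∈ G, q ∈ I) → ∃ I ∈ M, q ∈ I) ∧
      ∀ I ∈ M, ∃ p ∈ I, ∀ J ∈ M, p ∈ J → J = I := by
  classical
  obtain ⟨M, hM, hmin⟩ := Finset.exists_min_image
    (G.powerset.filter fun M => ∀ q : ℝ, (∃ I ∈ G, q ∈ I) → ∃ I ∈ M, q ∈ I) Finset.card
    ⟨G, by simpa using fun q I hI hq => ⟨I, hI, hq⟩⟩
  simp only [Finset.mem_filter, Finset.mem_powerset] at hM hmin
  refine ⟨M, hM.1, hM.2, fun I hI => ?_⟩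
  by_contra! hcon
  have := hmin (M.erase I) ⟨(Finset.erase_subset _ _).trans hM.1, fun q hq => ?_⟩
  · exact absurd this (not_le.2 (Finset.card_erase_lt_of_mem hI))
  · obtain ⟨J, hJ, hqJ⟩ := hM.2 q hq
    by_cases hJI : J = I
    · subst hJI
      obtain ⟨K, hK, hqK, hne⟩ := hcon q hqJ
      exact ⟨K, Finset.mem_erase.2 ⟨hne, hK⟩, hqK⟩
    · exact ⟨J, Finset.mem_erase.2 ⟨hJI, hJ⟩, hqJ⟩

/-- Order the minimal subcover by private points. If two members meet, their union is connected, so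
a private point strictly between theirs would lie in one of them. Hence members that meet are
consecutive, and coloring by the parity of the rank separates them. -/
theorem exists_coverColor (G : Finset (NonemptyInterval ℝ)) :
    ∃ c : NonemptyInterval ℝ → ℕ, (∀ I, c I < 3) ∧
      (∀ q : ℝ, (∃ I ∈ G, q ∈ I) → ∃ I ∈ G, q ∈ I ∧ c I ≠ 0) ∧
      ∀ I ∈ G, ∀ J ∈ G, c I ≠ 0 → c J = c I → ∀ q : ℝ, q ∈ I → q ∈ J → J = I := by
  classical
  obtain ⟨M, hMG, hcov, hpriv⟩ := exists_cover_with_private_points G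
  choose! p hpI hpJ using hpriv
  let r : NonemptyInterval ℝ → ℕ := fun I => (M.filter fun K => p K < p I).card
  have hr : ∀ I ∈ M, ∀ J ∈ M, p I < p J → ∀ q : ℝ, q ∈ I → q ∈ J → r J = r I + 1 := by
    intro I hI J hJ hIJ q hqI hqJ
    have hset : (M.filter fun K => p K < p J) = insert I (M.filter fun K => p K < p I) := by
      ext K
      simp only [Finset.mem_filter, Finset.mem_insert]
      constructor
      · rintro ⟨hK, hKJ⟩
        by_contra! hcon
        have hIK : p I ≤ p K := hcon.2 hK
        rcases le_total q (p K) with h | h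
        · have : p K ∈ J := ⟨hqJ.1.trans h, hKJ.le.trans (hpI J hJ).2⟩
          have h2 := hpJ K hK J hJ this
          exact absurd hKJ (by rw [h2]; exact lt_irrefl _)
        · have : p K ∈ I := ⟨(hpI I hI).1.trans hIK, h.trans hqI.2⟩
          exact hcon.1 (hpJ K hK I hI this).symm
      · rintro (rfl | ⟨hK, hKI⟩)
        · exact ⟨hI, hIJ⟩
        · exact ⟨hK, hKI.trans hIJ⟩
    change (M.filter fun K => p K < p J).card = (M.filter fun K => p K < p I).card + 1
    rw [hset, Finset.card_insert_of_notMem (by simp)]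
  refine ⟨fun I => if I ∈ M then 1 + r I % 2 else 0, fun I => ?_, fun q hq => ?_, ?_⟩
  · dsimp only
    split_ifs <;> omega
  · obtain ⟨I, hI, hqI⟩ := hcov q hq
    exact ⟨I, hMG hI, hqI, by simp [hI]⟩
  · intro I _ J _ h0 hc q hqI hqJ
    have hI : I ∈ M := by
      by_contra h
      simp [h] at h0
    have hJ : J ∈ M := by
      by_contra h
      simp [h, hI] at hc
      omega
    simp only [hI, hJ, if_true] at hc
    rcases lt_trichotomy (p I) (p J) with h | h | h
    · have := hr I hI J hJ h q hqI hqJ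
      omega
    · exact hpJ I hI J hJ (h ▸ hpI J hJ)
    · have := hr J hJ I hI h q hqJ hqI
      omega

/-- A coloring of a finite family `G` of intervals with colors `0, 1, 2` such that the intervals
of colors `1` and `2` cover the union of `G`, and those of equal such color are disjoint. -/
noncomputable def coverColor (G : Finset (NonemptyInterval ℝ)) : NonemptyInterval ℝ → ℕ :=
  (exists_coverColor G).choose

theorem coverColor_lt (G : Finset (NonemptyInterval ℝ)) (I : NonemptyInterval ℝ) :
    coverColor G I < 3 :=
  (exists_coverColor G).choose_spec.1 I

theorem exists_coverColor_ne_zero {G : Finset (NonemptyInterval ℝ)} {q : ℝ}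
    (h : ∃ I ∈ G, q ∈ I) : ∃ I ∈ G, q ∈ I ∧ coverColor G I ≠ 0 :=
  (exists_coverColor G).choose_spec.2.1 q h

theorem eq_of_coverColor_eq {G : Finset (NonemptyInterval ℝ)} {I J : NonemptyInterval ℝ}
    (hI : I ∈ G) (hJ : J ∈ G) (h0 : coverColor G I ≠ 0) (h : coverColor G J = coverColor G I)
    {q : ℝ} (hqI : q ∈ I) (hqJ : q ∈ J) : J = I :=
  (exists_coverColor G).choose_spec.2.2 I hI J hJ h0 h q hqI hqJ

theorem isConflictFree_coverColor (S : Finset (NonemptyInterval ℝ)) :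
    IsConflictFree S (coverColor S) := by
  intro q hq
  obtain ⟨I, hI, hqI, h0⟩ := exists_coverColor_ne_zero hq
  exact ⟨I, hI, hqI, fun J hJ hqJ h => eq_of_coverColor_eq hI hJ h0 h hqI hqJ⟩

/-! ### Chains of separators -/

open Classical in
/-- The points of `D` in the interval `I`. -/
noncomputable def pointsIn (D : Finset ℝ) (I : NonemptyInterval ℝ) : Finset ℝ :=
  D.filter (· ∈ I)

theorem mem_pointsIn {D : Finset ℝ} {I : NonemptyInterval ℝ} {x : ℝ} :
    x ∈ pointsIn D I ↔ x ∈ D ∧ x ∈ I := by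
  simp [pointsIn]

theorem pointsIn_subset (D : Finset ℝ) (I : NonemptyInterval ℝ) : pointsIn D I ⊆ D :=
  fun _ hx => (mem_pointsIn.1 hx).1

/-- Every interval without a point of `Q` contains at most `a` points of `D`. -/
def SparseBetween (a : ℝ) (D Q : Finset ℝ) : Prop :=
  ∀ I : NonemptyInterval ℝ, ¬ Hits I Q → ((pointsIn D I).card : ℝ) ≤ a

theorem SparseBetween.mono_left {a : ℝ} {D D' Q : Finset ℝ} (h : SparseBetween a D Q)
    (hD : D' ⊆ D) : SparseBetween a D' Q := by
  intro I hI
  refine le_trans ?_ (h I hI)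
  exact_mod_cast Finset.card_le_card fun x hx =>
    mem_pointsIn.2 ⟨hD (mem_pointsIn.1 hx).1, (mem_pointsIn.1 hx).2⟩

theorem SparseBetween.of_card_le {a : ℝ} {D : Finset ℝ} (h : (D.card : ℝ) ≤ a) (Q : Finset ℝ) :
    SparseBetween a D Q := by
  intro I _
  refine le_trans ?_ h
  exact_mod_cast Finset.card_le_card (pointsIn_subset D I)

/-- If `Q` has many points compared to `D`, then one of them, outside a given smaller set `R`, can
be removed such that `D` remains sparse between the points of `Q`. -/
theorem exists_removable_separator {a : ℝ} (ha : 0 < a) {D Q R : Finset ℝ}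
    (hsp : SparseBetween a D Q) (hR : 2 * R.card < Q.card) (hRQ : R ⊆ Q)
    (hD : 4 * (D.card : ℝ) ≤ a * Q.card) :
    ∃ q ∈ Q, q ∉ R ∧ SparseBetween a D (Q.erase q) := by
  classical
  by_contra! hcon
  -- If `q` cannot be removed, the witnessing interval with too many points of `D` must contain `q`,
  -- as otherwise it would already violate the sparsity for `Q`.
  have hex : ∀ q ∈ Q \ R, ∃ I : NonemptyInterval ℝ, ¬ Hits I (Q.erase q) ∧ q ∈ I ∧
      a < (pointsIn D I).card := by
    intro q hq
    rw [Finset.mem_sdiff] at hq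
    have := hcon q hq.1 hq.2
    simp only [SparseBetween, not_forall, not_le] at this
    obtain ⟨I, hI, hlt⟩ := this
    refine ⟨I, hI, ?_, hlt⟩
    by_contra hqI
    refine absurd (hsp I ?_) (not_le.2 hlt)
    rintro ⟨p, hp, hpI⟩
    refine hI ⟨p, Finset.mem_erase.2 ⟨?_, hp⟩, hpI⟩
    rintro rfl
    exact hqI hpI
  choose! I hmiss hmem hlt using hex
  have hno : ∀ q ∈ Q \ R, ∀ q' ∈ Q \ R, q' ∈ I q → q' = q := by
    intro q hq q' hq' h
    by_contra hne
    exact hmiss q hq ⟨q', Finset.mem_erase.2 ⟨hne, (Finset.mem_sdiff.1 hq').1⟩, h⟩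
  have hdouble : ∑ q ∈ Q \ R, (pointsIn D (I q)).card =
      ∑ d ∈ D, (Finset.card {q ∈ Q \ R | d ∈ I q} : ℕ) :=
    Finset.sum_card_bipartiteAbove_eq_sum_card_bipartiteBelow (s := Q \ R) (t := D)
      (fun q d => d ∈ I q)
  -- Of two witnesses through `d` whose separators lie on the same side of `d`, the one with the
  -- farther separator would contain the nearer one. So there is at most one per side.
  have htwo : ∀ d ∈ D, Finset.card {q ∈ Q \ R | d ∈ I q} ≤ 2 := by
    intro d _
    rw [← Finset.card_filter_add_card_filter_not (s := {q ∈ Q \ R | d ∈ I q}) (fun q => q ≤ d)]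
    refine Nat.add_le_add (Finset.card_le_one.2 ?_) (Finset.card_le_one.2 ?_)
    · simp only [Finset.mem_filter]
      rintro q ⟨⟨hq, hdq⟩, hqd⟩ q' ⟨⟨hq', hdq'⟩, hqd'⟩
      rcases le_total q q' with h | h
      · exact (hno q hq q' hq' ⟨(hmem q hq).1.trans h, hqd'.trans hdq.2⟩).symm
      · exact hno q' hq' q hq ⟨(hmem q' hq').1.trans h, hqd.trans hdq'.2⟩
    · simp only [Finset.mem_filter, not_le]
      rintro q ⟨⟨hq, hdq⟩, hqd⟩ q' ⟨⟨hq', hdq'⟩, hqd'⟩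
      rcases le_total q q' with h | h
      · exact hno q' hq' q hq ⟨hdq'.1.trans hqd.le, h.trans (hmem q' hq').2⟩
      · exact (hno q hq q' hq' ⟨hdq.1.trans hqd'.le, h.trans (hmem q hq).2⟩).symm
  have hupper : ∑ q ∈ Q \ R, ((pointsIn D (I q)).card : ℝ) ≤ 2 * D.card := by
    have h1 := Finset.sum_le_card_nsmul D _ 2 htwo
    rw [← hdouble, smul_eq_mul, mul_comm] at h1
    exact_mod_cast h1
  have hlower : ((Q \ R).card : ℝ) * a ≤ ∑ q ∈ Q \ R, ((pointsIn D (I q)).card : ℝ) := by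
    have h1 := Finset.card_nsmul_le_sum (Q \ R) (fun q => ((pointsIn D (I q)).card : ℝ)) a
      (fun q hq => (hlt q hq).le)
    rwa [nsmul_eq_mul] at h1
  have hcard : (Q.card : ℝ) < 2 * (Q \ R).card := by
    have := Finset.card_sdiff_of_subset hRQ
    have h2 : Q.card < 2 * (Q \ R).card := by omega
    exact_mod_cast h2
  -- The contradiction is `a * |Q \ R| ≤ 2 * |D| ≤ a * |Q| / 2 < a * |Q \ R|`.
  nlinarith

/-- Removing points from the levels of `B`, at most one from each level other than level `0`, such
that level `ℓ` has at most `m / t ^ ℓ` points. -/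
theorem exists_pruned_chain {t : ℝ} (ht : 2 ≤ t) (m : ℕ) (B : ℕ → Finset ℝ)
    (hB : ∀ ℓ, B (ℓ + 2) ⊆ B (ℓ + 1)) (hcard : ∀ ℓ, ((B ℓ).card : ℝ) * t ^ ℓ ≤ m + t ^ ℓ)
    (hsp : ∀ ℓ, SparseBetween (6 * t) (B ℓ) (B (ℓ + 1))) :
    ∃ P : ℕ → Finset ℝ, ∀ ℓ, P ℓ ⊆ B (ℓ + 1) ∧ (B (ℓ + 1) \ P ℓ).card ≤ 1 ∧
      ((P ℓ).card : ℝ) * t ^ (ℓ + 1) ≤ m ∧ P (ℓ + 1) ⊆ P ℓ ∧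
      SparseBetween (6 * t) (B ℓ) (P ℓ) := by
  obtain ⟨N, hN⟩ := pow_unbounded_of_one_lt (m : ℝ) (by linarith : 1 < t)
  have hsmall : ∀ ℓ, N ≤ ℓ → (B ℓ).card ≤ 1 := by
    intro ℓ hℓ
    have h1 : t ^ N ≤ t ^ ℓ := pow_le_pow_right₀ (by linarith) hℓ
    have h2 := hcard ℓ
    have h3 : 0 < t ^ ℓ := by positivity
    by_contra! h
    have h4 : (2 : ℝ) ≤ (B ℓ).card := by exact_mod_cast h
    nlinarith
  -- Pruning runs from the top level downwards, because the point discarded from a level must avoid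
  -- the already pruned level above it if the chain is to stay nested. From level `N` on there is at
  -- most one point per level, and the empty set serves. Note the shift: `P ℓ` is the pruned `B (ℓ +
  -- 1)`.
  have key : ∀ k, k ≤ N → ∃ P : ℕ → Finset ℝ, ∀ ℓ, k ≤ ℓ → P ℓ ⊆ B (ℓ + 1) ∧
      (B (ℓ + 1) \ P ℓ).card ≤ 1 ∧ ((P ℓ).card : ℝ) * t ^ (ℓ + 1) ≤ m ∧ P (ℓ + 1) ⊆ P ℓ ∧
      SparseBetween (6 * t) (B ℓ) (P ℓ) := by
    intro k hk
    induction hk using Nat.decreasingInduction with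
    | self =>
      refine ⟨fun _ => ∅, fun ℓ hℓ => ⟨by simp, ?_, by simp, by simp, ?_⟩⟩
      · simpa using hsmall (ℓ + 1) (by omega)
      · refine SparseBetween.of_card_le ?_ _
        have : ((B ℓ).card : ℝ) ≤ 1 := by exact_mod_cast hsmall ℓ hℓ
        linarith
    | of_succ k hk ih =>
      obtain ⟨P, hP⟩ := ih
      obtain ⟨hR1, -, hR3, -, -⟩ := hP (k + 1) le_rfl
      have hRB : P (k + 1) ⊆ B (k + 1) := hR1.trans (hB k)
      suffices h : ∃ Q ⊆ B (k + 1), (B (k + 1) \ Q).card ≤ 1 ∧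
          ((Q.card : ℕ) : ℝ) * t ^ (k + 1) ≤ m ∧ P (k + 1) ⊆ Q ∧
          SparseBetween (6 * t) (B k) Q by
        obtain ⟨Q, hQ⟩ := h
        refine ⟨Function.update P k Q, fun ℓ hℓ => ?_⟩
        rcases hℓ.eq_or_lt with rfl | hℓ
        · simpa using hQ
        · have := hP ℓ hℓ
          rwa [Function.update_of_ne (by omega), Function.update_of_ne (by omega)]
      by_cases hle : ((B (k + 1)).card : ℝ) * t ^ (k + 1) ≤ m
      · exact ⟨B (k + 1), subset_rfl, by simp, hle, hRB, hsp k⟩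
      have ht0 : 0 < t ^ (k + 1) := by positivity
      have ht1 : 0 < t ^ k := by positivity
      have hpos : (1 : ℝ) ≤ (B (k + 1)).card := by
        have : (B (k + 1)).card ≠ 0 := by
          intro h0
          rw [h0] at hle
          simp at hle
        exact_mod_cast Nat.one_le_iff_ne_zero.2 this
      push Not at hle
      -- The level is overfull, so `m < |B (k + 1)| * t ^ (k + 1)`. This gives `t * |P (k + 1)| < |B
      -- (k + 1)|` and `|B k| < t * |B (k + 1)| + 1`. The constant 6 arises from `4 * t * b + 4 ≤ 6
      -- * t * b` for `b ≥ 1`, `t ≥ 2`.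
      obtain ⟨q, hqB, hqR, hq⟩ := exists_removable_separator (by linarith : 0 < 6 * t) (hsp k)
        (R := P (k + 1)) (by
          have h1 : ((P (k + 1)).card : ℝ) * t * t ^ (k + 1) < (B (k + 1)).card * t ^ (k + 1) := by
            refine lt_of_le_of_lt (le_of_eq ?_) (hR3.trans_lt hle)
            ring
          have h2 := lt_of_mul_lt_mul_right h1 ht0.le
          have h3 : (2 : ℝ) * (P (k + 1)).card < (B (k + 1)).card := by
            nlinarith [Nat.cast_nonneg (α := ℝ) (P (k + 1)).card]
          exact_mod_cast h3) hRB (by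
          have h1 : ((B k).card : ℝ) * t ^ k < ((B (k + 1)).card * t + 1) * t ^ k := by
            have := hcard k
            rw [pow_succ] at hle
            nlinarith
          have h2 := lt_of_mul_lt_mul_right h1 ht1.le
          nlinarith)
      refine ⟨(B (k + 1)).erase q, Finset.erase_subset _ _, ?_, ?_, ?_, hq⟩
      · rw [Finset.sdiff_erase hqB]
        simp
      · rw [Finset.card_erase_of_mem hqB, Nat.cast_sub (by exact_mod_cast hpos)]
        have := hcard (k + 1)
        push_cast
        linarith
      · exact fun x hx => Finset.mem_erase.2 ⟨fun h => hqR (h ▸ hx), hRB hx⟩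
  obtain ⟨P, hP⟩ := key 0 (Nat.zero_le _)
  exact ⟨P, fun ℓ => hP ℓ (Nat.zero_le _)⟩

/-- The set of the left endpoints of the intervals of `S`. -/
noncomputable def leftEndpoints (S : Finset (NonemptyInterval ℝ)) : Finset ℝ :=
  S.image fun I => I.fst

/-- A decreasing chain `P 1 ⊇ P 2 ⊇ …` of sets of separators for `S`, where `P 0` consists of the
left endpoints: level `ℓ` has at most `|S| / t ^ ℓ` points, of which `O(t)` lie between two
consecutive points of level `ℓ + 1`. -/
structure IsSeparatorChain (t : ℝ) (S : Finset (NonemptyInterval ℝ)) (P : ℕ → Finset ℝ) :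
    Prop where
  zero : P 0 = leftEndpoints S
  -- Nesting is not required between levels 1 and 0: a separator may outlive the interval whose left
  -- endpoint it was.
  subset : ∀ ℓ, P (ℓ + 2) ⊆ P (ℓ + 1)
  card_le : ∀ ℓ, ((P ℓ).card : ℝ) * t ^ ℓ ≤ S.card
  sparse : ∀ ℓ, SparseBetween (6 * t) (P ℓ) (P (ℓ + 1))

theorem isSeparatorChain_empty {t : ℝ} (ht : 2 ≤ t) : IsSeparatorChain t ∅ fun _ => ∅ where
  zero := by simp [leftEndpoints]
  subset := by simp
  card_le := by simp
  sparse := fun _ => SparseBetween.of_card_le (by simp; linarith) _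

/-- The repair step behind both kinds of update: levels that exceed their size bound by at most one
point become a genuine chain after dropping at most one point each. -/
theorem exists_isSeparatorChain_of_levels {t : ℝ} (ht : 2 ≤ t) {S : Finset (NonemptyInterval ℝ)}
    {B : ℕ → Finset ℝ} (h0 : B 0 = leftEndpoints S) (hB : ∀ ℓ, B (ℓ + 2) ⊆ B (ℓ + 1))
    (hcard : ∀ ℓ, ((B ℓ).card : ℝ) * t ^ ℓ ≤ S.card + t ^ ℓ)
    (hsp : ∀ ℓ, SparseBetween (6 * t) (B ℓ) (B (ℓ + 1))) :
    ∃ P, IsSeparatorChain t S P ∧ ∀ ℓ, P ℓ ⊆ B ℓ ∧ (B ℓ \ P ℓ).card ≤ 1 := by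
  obtain ⟨P, hP⟩ := exists_pruned_chain ht S.card B hB hcard hsp
  have hsub : ∀ ℓ, Nat.rec (motive := fun _ => Finset ℝ) (B 0) (fun k _ => P k) ℓ ⊆ B ℓ ∧
      (B ℓ \ Nat.rec (motive := fun _ => Finset ℝ) (B 0) (fun k _ => P k) ℓ).card ≤ 1 := by
    rintro (_ | ℓ)
    · simp
    · exact ⟨(hP ℓ).1, (hP ℓ).2.1⟩
  refine ⟨fun ℓ => Nat.rec (B 0) (fun k _ => P k) ℓ, ⟨h0, fun ℓ => (hP ℓ).2.2.2.1, ?_, fun ℓ => ?_⟩,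
    hsub⟩
  · rintro (_ | ℓ)
    · simpa [h0, leftEndpoints] using Finset.card_image_le
    · exact (hP ℓ).2.2.1
  · exact (hP ℓ).2.2.2.2.mono_left (hsub ℓ).1

/-- A chain of separators can be maintained with two changes at each level. -/
theorem IsSeparatorChain.exists_update {t : ℝ} (ht : 2 ≤ t) {S : Finset (NonemptyInterval ℝ)}
    {P : ℕ → Finset ℝ} (hP : IsSeparatorChain t S P) (u : IntervalUpdate) :
    ∃ P', IsSeparatorChain t (u.apply S) P' ∧ ∀ ℓ, (symmDiff (P ℓ) (P' ℓ)).card ≤ 2 := by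
  cases u with
  | insert I =>
    rw [IntervalUpdate.apply]
    by_cases hI : I ∈ S
    · rw [Finset.insert_eq_of_mem hI]
      exact ⟨P, hP, by simp⟩
    -- The new left endpoint joins every level. Sparsity survives because an interval avoiding the
    -- enlarged level `ℓ + 1` avoids the new point as well. The two changes of a level are this
    -- point and the one pruned.
    obtain ⟨P', hP', hsub⟩ := exists_isSeparatorChain_of_levels ht (S := insert I S)
      (B := fun ℓ => insert I.fst (P ℓ)) (by simp [hP.zero, leftEndpoints])
      (fun ℓ => Finset.insert_subset_insert _ (hP.subset ℓ)) (fun ℓ => by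
        have h1 : ((insert I.fst (P ℓ)).card : ℝ) ≤ (P ℓ).card + 1 := by
          exact_mod_cast Finset.card_insert_le _ _
        have h2 := hP.card_le ℓ
        have h3 : 0 < t ^ ℓ := by positivity
        rw [Finset.card_insert_of_notMem hI]
        push_cast
        nlinarith) (fun ℓ J hJ => by
        refine le_trans ?_ (hP.sparse ℓ J fun h => hJ (h.mono_right (Finset.subset_insert _ _)))
        refine Nat.cast_le.2 (Finset.card_le_card fun x hx => ?_)
        obtain ⟨hx, hxJ⟩ := mem_pointsIn.1 hx
        refine mem_pointsIn.2 ⟨(Finset.mem_insert.1 hx).resolve_left ?_, hxJ⟩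
        rintro rfl
        exact hJ ⟨_, Finset.mem_insert_self _ _, hxJ⟩)
    refine ⟨P', hP', fun ℓ => ?_⟩
    have h1 : symmDiff (P ℓ) (P' ℓ) ⊆ insert I.fst (insert I.fst (P ℓ) \ P' ℓ) := by
      intro x hx
      have := @(hsub ℓ).1 x
      simp only [Finset.mem_symmDiff, Finset.mem_insert, Finset.mem_sdiff] at hx this ⊢
      tauto
    exact (Finset.card_le_card h1).trans ((Finset.card_insert_le _ _).trans
      (Nat.succ_le_succ (hsub ℓ).2))
  | delete I =>
    rw [IntervalUpdate.apply]
    by_cases hI : I ∈ S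
    swap
    · rw [Finset.erase_eq_of_notMem hI]
      exact ⟨P, hP, by simp⟩
    have hcard : (S.card : ℝ) = (S.erase I).card + 1 := by
      exact_mod_cast (Finset.card_erase_add_one hI).symm
    have hE : leftEndpoints (S.erase I) ⊆ P 0 :=
      hP.zero ▸ Finset.image_subset_image (Finset.erase_subset _ _)
    -- Only level 0 loses an endpoint. Higher levels keep their points, and since `1 ≤ t ^ ℓ`, the
    -- decrease of `|S|` by one makes them too large by at most one point.
    obtain ⟨P', hP', hsub⟩ := exists_isSeparatorChain_of_levels ht (S := S.erase I)
      (B := Function.update P 0 (leftEndpoints (S.erase I))) (by simp)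
      (fun ℓ => by simpa using hP.subset ℓ) (fun ℓ => by
        have h1 : (1 : ℝ) ≤ t ^ ℓ := one_le_pow₀ (by linarith)
        have h2 := hP.card_le ℓ
        have h3 : ((Function.update P 0 (leftEndpoints (S.erase I)) ℓ).card : ℝ) ≤ (P ℓ).card := by
          refine Nat.cast_le.2 (Finset.card_le_card ?_)
          rcases ℓ with _ | ℓ
          · simpa using hE
          · simp
        nlinarith) (fun ℓ => by
        rw [Function.update_of_ne (Nat.succ_ne_zero ℓ)]
        refine (hP.sparse ℓ).mono_left ?_
        rcases ℓ with _ | ℓ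
        · simpa using hE
        · simp)
    refine ⟨P', hP', fun ℓ => ?_⟩
    rcases ℓ with _ | ℓ
    · have h1 : symmDiff (P 0) (P' 0) ⊆ {I.fst} := by
        intro x hx
        rw [hP.zero, hP'.zero] at hx
        simp only [leftEndpoints, Finset.mem_symmDiff, Finset.mem_image, Finset.mem_erase,
          Finset.mem_singleton] at hx ⊢
        rcases hx with ⟨⟨J, hJ, rfl⟩, h⟩ | ⟨⟨J, hJ, rfl⟩, h⟩
        · by_contra hne
          exact h ⟨J, ⟨fun h => hne (h ▸ rfl), hJ⟩, rfl⟩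
        · exact absurd ⟨J, hJ.2, rfl⟩ h
      exact (Finset.card_le_card h1).trans (by simp)
    · have h1 : symmDiff (P (ℓ + 1)) (P' (ℓ + 1)) ⊆ P (ℓ + 1) \ P' (ℓ + 1) := by
        intro x hx
        have := @(hsub (ℓ + 1)).1 x
        simp only [Finset.mem_symmDiff, Finset.mem_sdiff, ne_eq, Nat.succ_ne_zero,
          not_false_eq_true, Function.update_of_ne] at hx this ⊢
        tauto
      have h2 := (hsub (ℓ + 1)).2
      simp only [ne_eq, Nat.succ_ne_zero, not_false_eq_true, Function.update_of_ne] at h2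
      exact (Finset.card_le_card h1).trans (h2.trans (by norm_num))

theorem exists_isSeparatorChain {t : ℝ} (ht : 2 ≤ t) (S : Finset (NonemptyInterval ℝ)) :
    ∃ P, IsSeparatorChain t S P := by
  induction S using Finset.induction_on with
  | empty => exact ⟨_, isSeparatorChain_empty ht⟩
  | insert I S _ ih =>
    obtain ⟨P, hP⟩ := ih
    obtain ⟨P', hP', -⟩ := hP.exists_update ht (.insert I)
    exact ⟨P', hP'⟩

/-! ### The coloring defined by a chain of separators -/

/-- The level of an interval: the largest `ℓ` such that it contains a point of level `ℓ`. -/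
noncomputable def chainLevel (P : ℕ → Finset ℝ) (I : NonemptyInterval ℝ) : ℕ :=
  sInf {ℓ | ¬ Hits I (P (ℓ + 1))}

open Classical in
/-- The intervals of level `ℓ` of `S` that lie between the same two consecutive points of level
`ℓ + 1` as `I`. -/
noncomputable def chainGroup (S : Finset (NonemptyInterval ℝ)) (P : ℕ → Finset ℝ) (ℓ : ℕ)
    (I : NonemptyInterval ℝ) : Finset (NonemptyInterval ℝ) :=
  S.filter fun J => Hits J (P ℓ) ∧ ¬ Hits (I ⊔ J) (P (ℓ + 1))

/-- The coloring defined by a chain of separators: the groups of level `ℓ` are colored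
independently with the colors `0`, `2 * ℓ + 1`, `2 * ℓ + 2`. -/
noncomputable def chainColor (S : Finset (NonemptyInterval ℝ)) (P : ℕ → Finset ℝ)
    (I : NonemptyInterval ℝ) : ℕ :=
  if coverColor (chainGroup S P (chainLevel P I) I) I = 0 then 0
  else 2 * chainLevel P I + coverColor (chainGroup S P (chainLevel P I) I) I

theorem mem_chainGroup {S : Finset (NonemptyInterval ℝ)} {P : ℕ → Finset ℝ} {ℓ : ℕ}
    {I J : NonemptyInterval ℝ} :
    J ∈ chainGroup S P ℓ I ↔ J ∈ S ∧ Hits J (P ℓ) ∧ ¬ Hits (I ⊔ J) (P (ℓ + 1)) := by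
  simp [chainGroup]

theorem chainColor_ne_zero {S : Finset (NonemptyInterval ℝ)} {P : ℕ → Finset ℝ}
    {I : NonemptyInterval ℝ} (h : chainColor S P I ≠ 0) :
    coverColor (chainGroup S P (chainLevel P I) I) I ≠ 0 := by
  intro h0
  simp [chainColor, h0] at h

theorem chainColor_le (S : Finset (NonemptyInterval ℝ)) (P : ℕ → Finset ℝ)
    (I : NonemptyInterval ℝ) : chainColor S P I ≤ 2 * chainLevel P I + 2 := by
  have := coverColor_lt (chainGroup S P (chainLevel P I) I) I
  rw [chainColor]
  split_ifs <;> omega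

/-- If the intervals `I`, `J` meet and contain no point of `F`, then neither does their union. -/
theorem not_hits_sup_of_common_point {I J : NonemptyInterval ℝ} {F : Finset ℝ} {q : ℝ}
    (hqI : q ∈ I) (hqJ : q ∈ J) (hI : ¬ Hits I F) (hJ : ¬ Hits J F) : ¬ Hits (I ⊔ J) F := by
  rintro ⟨p, hp, hpIJ⟩
  have hI' : p ∉ I := fun h => hI ⟨p, hp, h⟩
  have hJ' : p ∉ J := fun h => hJ ⟨p, hp, h⟩
  rw [mem_interval] at hqI hqJ hI' hJ'
  rw [mem_sup_interval] at hpIJ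
  grind

/-- Both hulls contain `J`, so they share a point. Lying in the same gap of `F` is thus transitive,
and a group does not depend on the interval that names it. -/
theorem not_hits_sup_trans {I J K : NonemptyInterval ℝ} {F : Finset ℝ}
    (hIJ : ¬ Hits (I ⊔ J) F) (hJK : ¬ Hits (J ⊔ K) F) : ¬ Hits (I ⊔ K) F := by
  have := not_hits_sup_of_common_point (q := J.fst)
    (mem_sup_interval.2 ⟨Or.inr le_rfl, Or.inr J.fst_le_snd⟩)
    (mem_sup_interval.2 ⟨Or.inl le_rfl, Or.inl J.fst_le_snd⟩) hIJ hJK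
  exact fun h => this (h.mono (sup_le_sup le_sup_left le_sup_right))

theorem chainGroup_eq_of_not_hits {S : Finset (NonemptyInterval ℝ)} {P : ℕ → Finset ℝ} {ℓ : ℕ}
    {I J : NonemptyInterval ℝ} (h : ¬ Hits (I ⊔ J) (P (ℓ + 1))) :
    chainGroup S P ℓ I = chainGroup S P ℓ J := by
  ext K
  rw [mem_chainGroup, mem_chainGroup]
  have h1 : ¬ Hits (I ⊔ K) (P (ℓ + 1)) ↔ ¬ Hits (J ⊔ K) (P (ℓ + 1)) :=
    ⟨fun hK => not_hits_sup_trans (by rwa [sup_comm]) hK, fun hK => not_hits_sup_trans h hK⟩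
  rw [h1]

namespace IsSeparatorChain

variable {t : ℝ} {S : Finset (NonemptyInterval ℝ)} {P : ℕ → Finset ℝ}

theorem eq_empty (hP : IsSeparatorChain t S P) {ℓ : ℕ} (h : (S.card : ℝ) < t ^ ℓ) : P ℓ = ∅ := by
  by_contra hne
  have h1 : (1 : ℝ) ≤ (P ℓ).card := by
    exact_mod_cast Finset.card_pos.2 (Finset.nonempty_iff_ne_empty.2 hne)
  have h2 := hP.card_le ℓ
  have h3 : (0 : ℝ) < t ^ ℓ := (Nat.cast_nonneg _).trans_lt h
  nlinarith

theorem hits_of_le (hP : IsSeparatorChain t S P) {I : NonemptyInterval ℝ} {k ℓ : ℕ} (hk : k ≤ ℓ)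
    (h : Hits I (P (ℓ + 1))) : Hits I (P (k + 1)) :=
  h.mono_right (antitone_nat_of_succ_le (f := fun ℓ => P (ℓ + 1)) hP.subset hk)

/-- High levels are empty, so the infimum defining `chainLevel` is attained and is not the default
value 0 of an empty set. -/
theorem exists_not_hits (hP : IsSeparatorChain t S P) (ht : 2 ≤ t) (I : NonemptyInterval ℝ) :
    ∃ ℓ, ¬ Hits I (P (ℓ + 1)) := by
  obtain ⟨N, hN⟩ := pow_unbounded_of_one_lt (S.card : ℝ) (by linarith : 1 < t)
  refine ⟨N, ?_⟩
  rw [hP.eq_empty (hN.trans_le (pow_le_pow_right₀ (by linarith) N.le_succ))]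
  simp [Hits]

theorem not_hits_level (hP : IsSeparatorChain t S P) (ht : 2 ≤ t) (I : NonemptyInterval ℝ) :
    ¬ Hits I (P (chainLevel P I + 1)) :=
  Nat.sInf_mem (s := {ℓ | ¬ Hits I (P (ℓ + 1))}) (hP.exists_not_hits ht I)

theorem hits_level (hP : IsSeparatorChain t S P) {I : NonemptyInterval ℝ} (hI : I ∈ S) :
    Hits I (P (chainLevel P I)) := by
  rcases h : chainLevel P I with _ | k
  · exact ⟨I.fst, by rw [hP.zero]; exact Finset.mem_image_of_mem _ hI, le_rfl, I.fst_le_snd⟩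
  · by_contra hk
    have : chainLevel P I ≤ k := Nat.sInf_le hk
    omega

theorem level_eq (hP : IsSeparatorChain t S P) (ht : 2 ≤ t) {I : NonemptyInterval ℝ} {ℓ : ℕ}
    (h : Hits I (P ℓ)) (h' : ¬ Hits I (P (ℓ + 1))) : chainLevel P I = ℓ := by
  refine le_antisymm (Nat.sInf_le h') ?_
  by_contra! hlt
  obtain ⟨k, rfl⟩ : ∃ k, ℓ = k + 1 := ⟨ℓ - 1, by omega⟩
  exact hP.not_hits_level ht I (hP.hits_of_le (Nat.lt_succ_iff.1 hlt) h)

theorem level_lt (hP : IsSeparatorChain t S P) {M : ℕ} (hM : ∀ ℓ, M ≤ ℓ → P ℓ = ∅)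
    {I : NonemptyInterval ℝ} (hI : I ∈ S) : chainLevel P I < M := by
  by_contra! h
  have := hP.hits_level hI
  rw [hM _ h] at this
  simp [Hits] at this

theorem mem_group_self (hP : IsSeparatorChain t S P) (ht : 2 ≤ t) {I : NonemptyInterval ℝ}
    (hI : I ∈ S) : I ∈ chainGroup S P (chainLevel P I) I :=
  mem_chainGroup.2 ⟨hI, hP.hits_level hI, by rw [sup_idem]; exact hP.not_hits_level ht I⟩

theorem level_eq_of_mem_group (hP : IsSeparatorChain t S P) (ht : 2 ≤ t)
    {I J : NonemptyInterval ℝ} {ℓ : ℕ} (hJ : J ∈ chainGroup S P ℓ I) : chainLevel P J = ℓ := by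
  rw [mem_chainGroup] at hJ
  exact hP.level_eq ht hJ.2.1 fun h => hJ.2.2 (h.mono le_sup_right)

/-- Among the intervals of the group of `I`, some properly colored `K` contains `q`. Another
interval through `q` with the color of `K` has the same level, as proper colors determine the level.
It then lies in the same gap, because both contain `q` and avoid the next separators, and within one
group equal proper colors are disjoint. -/
theorem isConflictFree (hP : IsSeparatorChain t S P) (ht : 2 ≤ t) :
    IsConflictFree S (chainColor S P) := by
  rintro q ⟨I, hI, hqI⟩
  obtain ⟨K, hK, hqK, hK0⟩ := exists_coverColor_ne_zero ⟨I, hP.mem_group_self ht hI, hqI⟩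
  have hlev := hP.level_eq_of_mem_group ht hK
  have hKS := (mem_chainGroup.1 hK).1
  rw [chainGroup_eq_of_not_hits (mem_chainGroup.1 hK).2.2, ← hlev] at hK0
  refine ⟨K, hKS, hqK, fun L hL hqL hc => ?_⟩
  have h1 := coverColor_lt (chainGroup S P (chainLevel P K) K) K
  have h2 := coverColor_lt (chainGroup S P (chainLevel P L) L) L
  rw [chainColor, chainColor, if_neg hK0] at hc
  split_ifs at hc with hL0
  · omega
  have hlev' : chainLevel P L = chainLevel P K := by omega
  have hmiss := not_hits_sup_of_common_point hqK hqL (hP.not_hits_level ht K)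
    (hlev' ▸ hP.not_hits_level ht L)
  rw [hlev', ← chainGroup_eq_of_not_hits hmiss] at hc
  refine eq_of_coverColor_eq (hP.mem_group_self ht hKS) (mem_chainGroup.2 ⟨hL, ?_, hmiss⟩) hK0
    (by omega) hqK hqL
  rw [← hlev']
  exact hP.hits_level hL

theorem usesAtMostColors (hP : IsSeparatorChain t S P) {M : ℕ} (hM : ∀ ℓ, M ≤ ℓ → P ℓ = ∅)
    {m : ℝ} (hm : 2 * (M : ℝ) + 1 ≤ m) : UsesAtMostColors S (chainColor S P) m := by
  refine ⟨2 * M + 1, by push_cast; exact hm, fun I hI => ?_⟩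
  have h1 := chainColor_le S P I
  have h2 := hP.level_lt hM hI
  omega

/-- Between two consecutive separators of level `ℓ + 1` only `O(t)` intervals of level `ℓ` have a
nonzero color. -/
theorem card_le_of_pairwise (hP : IsSeparatorChain t S P) (ht : 2 ≤ t)
    {T : Finset (NonemptyInterval ℝ)} (hTS : T ⊆ S) {ℓ : ℕ} (hlev : ∀ I ∈ T, chainLevel P I = ℓ)
    (hcol : ∀ I ∈ T, chainColor S P I ≠ 0)
    (hpair : ∀ I ∈ T, ∀ J ∈ T, ¬ Hits (I ⊔ J) (P (ℓ + 1))) : (T.card : ℝ) ≤ 12 * t := by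
  classical
  rcases T.eq_empty_or_nonempty with rfl | hne
  · simp
    linarith
  -- The hull of the leftmost and the rightmost member contains all of `T` and still avoids level `ℓ
  -- + 1`, so it has at most `6 * t` points of level `ℓ`.
  obtain ⟨A, hA, hmin⟩ := Finset.exists_min_image T (fun I => I.fst) hne
  obtain ⟨B, hB, hmax⟩ := Finset.exists_max_image T (fun I => I.snd) hne
  have hhit : ∀ I ∈ T, ∃ d ∈ pointsIn (P ℓ) (A ⊔ B), d ∈ I := by
    intro I hI
    obtain ⟨d, hd, hdI⟩ := hP.hits_level (hTS hI)
    rw [hlev I hI] at hd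
    exact ⟨d, mem_pointsIn.2 ⟨hd, mem_sup_interval.2
      ⟨Or.inl ((hmin I hI).trans hdI.1), Or.inr (hdI.2.trans (hmax I hI))⟩⟩, hdI⟩
  choose! d hd hdI using hhit
  have hcov : ∀ I ∈ T, coverColor (chainGroup S P ℓ A) I ≠ 0 := by
    intro I hI
    have := chainColor_ne_zero (hcol I hI)
    rwa [hlev I hI, chainGroup_eq_of_not_hits (hpair I hI A hA)] at this
  have hmemG : ∀ I ∈ T, I ∈ chainGroup S P ℓ A := fun I hI =>
    mem_chainGroup.2 ⟨hTS hI, hlev I hI ▸ hP.hits_level (hTS hI), hpair A hA I hI⟩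
  -- A point of level `ℓ` in the interval, together with one of two proper colors, determines the
  -- interval; hence `12 * t`.
  have hcard : T.card ≤ (pointsIn (P ℓ) (A ⊔ B) ×ˢ ({1, 2} : Finset ℕ)).card := by
    refine Finset.card_le_card_of_injOn (fun I => (d I, coverColor (chainGroup S P ℓ A) I))
      (fun I hI => ?_) (fun I hI J hJ hIJ => ?_)
    · have h1 := coverColor_lt (chainGroup S P ℓ A) I
      have h2 := hcov I hI
      simp only [Finset.coe_product, Set.mem_prod, Finset.mem_coe, Finset.mem_insert,
        Finset.mem_singleton]
      exact ⟨hd I hI, by omega⟩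
    · simp only [Prod.mk.injEq] at hIJ
      exact eq_of_coverColor_eq (hmemG J hJ) (hmemG I hI) (hcov J hJ) hIJ.2 (q := d I)
        (hIJ.1 ▸ hdI J hJ) (hdI I hI)
  rw [Finset.card_product] at hcard
  have h1 := hP.sparse ℓ (A ⊔ B) (hpair A hA B hB)
  have h2 : (T.card : ℝ) ≤ (pointsIn (P ℓ) (A ⊔ B)).card * 2 := by exact_mod_cast hcard
  linarith

/-! ### Locality of the recoloring caused by one update -/

variable {S' : Finset (NonemptyInterval ℝ)} {P' : ℕ → Finset ℝ}

/-- Away from the changes of the separators, `I` is as far from the separators as before. -/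
theorem _root_.hits_sup_pure_iff {F F' : Finset ℝ} {I : NonemptyInterval ℝ} (hI : ¬ Hits I F)
    (hd : ∀ d ∈ symmDiff F F', ∃ p ∈ F, p ∈ I ⊔ NonemptyInterval.pure d ∧ p ≠ d) (x : ℝ) :
    Hits (I ⊔ NonemptyInterval.pure x) F ↔ Hits (I ⊔ NonemptyInterval.pure x) F' := by
  classical
  constructor
  · intro h
    by_contra h'
    -- Take the separator in the hull that is nearest to `I`. If it disappeared, the hypothesis
    -- would supply a still nearer one.
    obtain ⟨p, hp, hmin⟩ := Finset.exists_min_image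
      (pointsIn F (I ⊔ NonemptyInterval.pure x)) (fun p => max (I.fst - p) (p - I.snd)) (by
        obtain ⟨p, hp, hpI⟩ := h
        exact ⟨p, mem_pointsIn.2 ⟨hp, hpI⟩⟩)
    rw [mem_pointsIn] at hp
    have hpF' : p ∉ F' := fun h => h' ⟨p, h, hp.2⟩
    obtain ⟨r, hr, hrI, hrp⟩ := hd p (Finset.mem_symmDiff.2 (Or.inl ⟨hp.1, hpF'⟩))
    have hpx := hp.2
    have hpI : p ∉ I := fun h => hI ⟨p, hp.1, h⟩
    have hrI' : r ∉ I := fun h => hI ⟨r, hr, h⟩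
    have hle := I.fst_le_snd
    have hrx : r ∈ I ⊔ NonemptyInterval.pure x := by
      rw [mem_sup_pure] at hrI hpx ⊢
      grind
    have := hmin r (mem_pointsIn.2 ⟨hr, hrx⟩)
    rw [mem_sup_pure] at hrI hpx hrx
    rw [mem_interval] at hpI hrI'
    rcases lt_or_ge p I.fst with h1 | h1
    · rw [max_eq_left (by linarith)] at this
      grind
    · have h2 : I.snd < p := by grind
      rw [max_eq_right (by linarith)] at this
      grind
  · rintro ⟨p, hp, hpx⟩
    by_contra h
    have hpF : p ∉ F := fun hpF => h ⟨p, hpF, hpx⟩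
    obtain ⟨r, hr, hrI, -⟩ := hd p (Finset.mem_symmDiff.2 (Or.inr ⟨hp, hpF⟩))
    refine h ⟨r, hr, NonemptyInterval.coe_subset_coe.2 (sup_pure_le hpx |>.trans ?_) hrI⟩
    rw [← sup_assoc, sup_idem]

/-- The hull of `I` and `J` is the union of the stretches of `I` to the two endpoints of `J`. This
reduces questions about intervals `J` to the pointwise statement above. -/
theorem _root_.hits_sup_iff {F : Finset ℝ} {I J : NonemptyInterval ℝ} :
    Hits (I ⊔ J) F ↔ Hits (I ⊔ NonemptyInterval.pure J.fst) F ∨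
      Hits (I ⊔ NonemptyInterval.pure J.snd) F := by
  have hI := I.fst_le_snd
  have hJ := J.fst_le_snd
  have key : ∀ p, p ∈ I ⊔ J ↔ p ∈ I ⊔ NonemptyInterval.pure J.fst ∨
      p ∈ I ⊔ NonemptyInterval.pure J.snd := by
    intro p
    rw [mem_sup_pure, mem_sup_pure, mem_sup_interval]
    grind
  simp only [Hits, key]
  grind

/-- The color of an interval `I` far from all changes does not change. -/
theorem chainColor_eq (hP : IsSeparatorChain t S P) (hP' : IsSeparatorChain t S' P') (ht : 2 ≤ t)
    {X I : NonemptyInterval ℝ} (hX : ∀ J, J ≠ X → (J ∈ S ↔ J ∈ S')) {ℓ : ℕ} (hI : I ∈ S)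
    (hlev : chainLevel P I = ℓ)
    (hd : ∀ d ∈ insert X.fst (symmDiff (P ℓ) (P' ℓ) ∪ symmDiff (P (ℓ + 1)) (P' (ℓ + 1))),
      ∃ p ∈ P (ℓ + 1), p ∈ I ⊔ NonemptyInterval.pure d ∧ p ≠ d) :
    chainColor S P I = chainColor S' P' I := by
  have hmiss : ¬ Hits I (P (ℓ + 1)) := hlev ▸ hP.not_hits_level ht I
  have hpt : ∀ x, Hits (I ⊔ NonemptyInterval.pure x) (P (ℓ + 1)) ↔
      Hits (I ⊔ NonemptyInterval.pure x) (P' (ℓ + 1)) :=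
    hits_sup_pure_iff hmiss fun d h => hd d (by simp [h])
  have hsup : ∀ J, Hits (I ⊔ J) (P (ℓ + 1)) ↔ Hits (I ⊔ J) (P' (ℓ + 1)) := by
    intro J
    rw [hits_sup_iff, hpt, hpt, ← hits_sup_iff]
  -- An interval in the gap of `I` contains no point of change, since a separator stands between `I`
  -- and each such point. Therefore the members of this gap, their levels and the gap itself are the
  -- same before and after.
  have hfar : ∀ J, ¬ Hits (I ⊔ J) (P (ℓ + 1)) →
      ∀ d ∈ insert X.fst (symmDiff (P ℓ) (P' ℓ) ∪ symmDiff (P (ℓ + 1)) (P' (ℓ + 1))), d ∉ J := by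
    intro J hJ d hdm hdJ
    obtain ⟨p, hp, hpd, -⟩ := hd d hdm
    exact hJ ⟨p, hp, NonemptyInterval.coe_subset_coe.2 (sup_pure_le hdJ) hpd⟩
  have hhit : ∀ J, ¬ Hits (I ⊔ J) (P (ℓ + 1)) → (Hits J (P ℓ) ↔ Hits J (P' ℓ)) := by
    intro J hJ
    refine exists_congr fun p => ⟨fun ⟨hp, hpJ⟩ => ⟨?_, hpJ⟩, fun ⟨hp, hpJ⟩ => ⟨?_, hpJ⟩⟩
    all_goals
      by_contra h
      refine hfar J hJ p ?_ hpJ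
      simp [Finset.mem_symmDiff, hp, h]
  have hS : ∀ J, ¬ Hits (I ⊔ J) (P (ℓ + 1)) → (J ∈ S ↔ J ∈ S') := by
    intro J hJ
    refine hX J ?_
    rintro rfl
    exact hfar J hJ J.fst (by simp) ⟨le_rfl, J.fst_le_snd⟩
  have hself : ¬ Hits (I ⊔ I) (P (ℓ + 1)) := by rwa [sup_idem]
  have hlev' : chainLevel P' I = ℓ := by
    refine hP'.level_eq ht ((hhit I hself).1 (hlev ▸ hP.hits_level hI)) ?_
    have := (not_congr (hsup I)).1 hself
    rwa [sup_idem] at this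
  have hG : chainGroup S P ℓ I = chainGroup S' P' ℓ I := by
    ext J
    rw [mem_chainGroup, mem_chainGroup, ← hsup]
    by_cases hJ : Hits (I ⊔ J) (P (ℓ + 1))
    · simp [hJ]
    · rw [hhit J hJ, hS J hJ]
  rw [chainColor, chainColor, hlev, hlev', hG]

open Classical in
/-- The number of intervals with a nonzero color that are recolored, from one side. -/
theorem card_recolored_ne_zero_le (hP : IsSeparatorChain t S P) (hP' : IsSeparatorChain t S' P')
    (ht : 2 ≤ t) {X : NonemptyInterval ℝ} (hX : ∀ J, J ≠ X → (J ∈ S ↔ J ∈ S'))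
    (hΔ : ∀ ℓ, (symmDiff (P ℓ) (P' ℓ)).card ≤ 2) {M : ℕ} (hM : ∀ ℓ, M ≤ ℓ → P ℓ = ∅) :
    ((Finset.card {I ∈ S | chainColor S P I ≠ 0 ∧ chainColor S P I ≠ chainColor S' P' I} : ℕ) : ℝ)
      ≤ 120 * t * M := by
  -- The points of change relevant to level `ℓ`: one endpoint of the updated interval, and at most
  -- two separators from each of the levels `ℓ` and `ℓ + 1`.
  let D : ℕ → Finset ℝ := fun ℓ =>
    insert X.fst (symmDiff (P ℓ) (P' ℓ) ∪ symmDiff (P (ℓ + 1)) (P' (ℓ + 1)))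
  have hD : ∀ ℓ, (D ℓ).card ≤ 5 := fun ℓ => by
    have h1 := Finset.card_insert_le X.fst
      (symmDiff (P ℓ) (P' ℓ) ∪ symmDiff (P (ℓ + 1)) (P' (ℓ + 1)))
    have h2 := Finset.card_union_le (symmDiff (P ℓ) (P' ℓ)) (symmDiff (P (ℓ + 1)) (P' (ℓ + 1)))
    have h3 := hΔ ℓ
    have h4 := hΔ (ℓ + 1)
    simp only [D]
    omega
  let near : ℕ → ℝ → Finset (NonemptyInterval ℝ) := fun ℓ d =>
    {I ∈ S | chainLevel P I = ℓ ∧ chainColor S P I ≠ 0 ∧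
      ∀ p ∈ P (ℓ + 1), p ∈ I ⊔ NonemptyInterval.pure d → p = d}
  have hnearS : ∀ ℓ d, near ℓ d ⊆ S := by
    intro ℓ d I hI
    simp only [near, Finset.mem_filter] at hI
    exact hI.1
  have hnear : ∀ ℓ d, ((near ℓ d).card : ℝ) ≤ 24 * t := by
    intro ℓ d
    -- Intervals with no separator strictly between them and `d` form at most two gaps, one for each
    -- side of `d`, with at most `12 * t` properly colored intervals each. Intervals containing `d`
    -- are counted on the left.
    rw [← Finset.card_filter_add_card_filter_not (s := near ℓ d) (fun I => I.fst ≤ d)]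
    have h1 : ((Finset.card {I ∈ near ℓ d | I.fst ≤ d} : ℕ) : ℝ) ≤ 12 * t := by
      refine hP.card_le_of_pairwise ht (ℓ := ℓ) ?_ ?_ ?_ ?_
      · exact (Finset.filter_subset _ _).trans (hnearS ℓ d)
      · simp +contextual [near]
      · simp +contextual [near]
      · simp only [near, Finset.mem_filter]
        rintro I ⟨⟨hI, hl, -, h⟩, hId⟩ J ⟨⟨hJ, hl', -, h'⟩, hJd⟩ ⟨p, hp, hpm⟩
        have hpI : p ∉ I := fun hpI => hP.not_hits_level ht I ⟨p, hl ▸ hp, hpI⟩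
        have hpJ : p ∉ J := fun hpJ => hP.not_hits_level ht J ⟨p, hl' ▸ hp, hpJ⟩
        have e1 := h p hp
        have e2 := h' p hp
        rw [mem_sup_pure] at e1 e2
        rw [mem_sup_interval] at hpm
        rw [mem_interval] at hpI hpJ
        grind
    have h2 : ((Finset.card {I ∈ near ℓ d | ¬ I.fst ≤ d} : ℕ) : ℝ) ≤ 12 * t := by
      refine hP.card_le_of_pairwise ht (ℓ := ℓ) ?_ ?_ ?_ ?_
      · exact (Finset.filter_subset _ _).trans (hnearS ℓ d)
      · simp +contextual [near]
      · simp +contextual [near]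
      · simp only [near, Finset.mem_filter]
        rintro I ⟨⟨hI, hl, -, h⟩, hId⟩ J ⟨⟨hJ, hl', -, h'⟩, hJd⟩ ⟨p, hp, hpm⟩
        have e1 := h p hp
        have e2 := h' p hp
        rw [mem_sup_pure] at e1 e2
        rw [mem_sup_interval] at hpm
        grind
    push_cast
    linarith
  have hsub : ({I ∈ S | chainColor S P I ≠ 0 ∧ chainColor S P I ≠ chainColor S' P' I} :
      Finset (NonemptyInterval ℝ)) ⊆
      (Finset.range M).biUnion fun ℓ => (D ℓ).biUnion (near ℓ) := by
    intro I hI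
    simp only [Finset.mem_filter] at hI
    obtain ⟨hIS, h0, hne⟩ := hI
    by_contra hcon
    refine hne (hP.chainColor_eq hP' ht hX hIS rfl fun d hd => ?_)
    by_contra! hfar
    refine hcon (Finset.mem_biUnion.2 ⟨chainLevel P I, Finset.mem_range.2 (hP.level_lt hM hIS),
      Finset.mem_biUnion.2 ⟨d, hd, ?_⟩⟩)
    simp only [near, Finset.mem_filter]
    exact ⟨hIS, by trivial, h0, hfar⟩
  have h1 : ((Finset.card {I ∈ S | chainColor S P I ≠ 0 ∧
      chainColor S P I ≠ chainColor S' P' I} : ℕ) : ℝ) ≤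
      ∑ ℓ ∈ Finset.range M, ∑ d ∈ D ℓ, ((near ℓ d).card : ℝ) := by
    exact_mod_cast (Finset.card_le_card hsub).trans (Finset.card_biUnion_le.trans
      (Finset.sum_le_sum fun ℓ _ => Finset.card_biUnion_le))
  have h2 : ∑ ℓ ∈ Finset.range M, ∑ d ∈ D ℓ, ((near ℓ d).card : ℝ) ≤
      ∑ ℓ ∈ Finset.range M, 120 * t := by
    refine Finset.sum_le_sum fun ℓ _ => ?_
    refine (Finset.sum_le_card_nsmul _ _ _ fun d _ => hnear ℓ d).trans ?_
    have : ((D ℓ).card : ℝ) ≤ 5 := by exact_mod_cast hD ℓ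
    rw [nsmul_eq_mul]
    nlinarith
  rw [Finset.sum_const, Finset.card_range, nsmul_eq_mul] at h2
  linarith

/-- A changed color is nonzero before or after the update, so the one-sided bound is applied in both
directions. Intervals keeping the dummy color cost nothing, however many there are. -/
theorem card_recolored_le (hP : IsSeparatorChain t S P) (hP' : IsSeparatorChain t S' P')
    (ht : 2 ≤ t) {X : NonemptyInterval ℝ} (hX : ∀ J, J ≠ X → (J ∈ S ↔ J ∈ S'))
    (hΔ : ∀ ℓ, (symmDiff (P ℓ) (P' ℓ)).card ≤ 2) {M : ℕ}
    (hM : ∀ ℓ, M ≤ ℓ → P ℓ = ∅) (hM' : ∀ ℓ, M ≤ ℓ → P' ℓ = ∅) :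
    ((Finset.card {I ∈ S ∩ S' | chainColor S P I ≠ chainColor S' P' I} : ℕ) : ℝ) ≤
      240 * t * M := by
  classical
  have h1 := hP.card_recolored_ne_zero_le hP' ht hX hΔ hM
  have h2 := hP'.card_recolored_ne_zero_le hP ht (fun J hJ => (hX J hJ).symm)
    (fun ℓ => by rw [symmDiff_comm]; exact hΔ ℓ) hM'
  have h3 : ({I ∈ S ∩ S' | chainColor S P I ≠ chainColor S' P' I} :
      Finset (NonemptyInterval ℝ)) ⊆
      {I ∈ S | chainColor S P I ≠ 0 ∧ chainColor S P I ≠ chainColor S' P' I} ∪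
      {I ∈ S' | chainColor S' P' I ≠ 0 ∧ chainColor S' P' I ≠ chainColor S P I} := by
    intro I hI
    simp only [Finset.mem_filter, Finset.mem_inter, Finset.mem_union] at hI ⊢
    obtain ⟨⟨hS, hS'⟩, hne⟩ := hI
    by_cases h : chainColor S P I = 0
    · exact Or.inr ⟨hS', fun h' => hne (h.trans h'.symm), hne.symm⟩
    · exact Or.inl ⟨hS, h, hne⟩
  have h4 := (Finset.card_le_card h3).trans (Finset.card_union_le _ _)
  have h5 : ((Finset.card {I ∈ S ∩ S' | chainColor S P I ≠ chainColor S' P' I} : ℕ) : ℝ) ≤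
      (Finset.card {I ∈ S | chainColor S P I ≠ 0 ∧ chainColor S P I ≠ chainColor S' P' I} : ℕ) +
      (Finset.card {I ∈ S' | chainColor S' P' I ≠ 0 ∧
        chainColor S' P' I ≠ chainColor S P I} : ℕ) := by
    exact_mod_cast h4
  linarith

end IsSeparatorChain

/-! ### Strategies -/

/-- An invariant that can be maintained along every sequence of updates. -/
theorem exists_online_state {σ : Type*} (Inv : UpdateHistory → σ → Prop)
    (Rel : UpdateHistory → IntervalUpdate → σ → σ → Prop) (h0 : ∃ s, Inv [] s)
    (hstep : ∀ h u s, Inv h s → ∃ s', Inv (u :: h) s' ∧ Rel h u s s') :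
    ∃ F : UpdateHistory → σ, (∀ h, Inv h (F h)) ∧ ∀ h u, Rel h u (F h) (F (u :: h)) := by
  obtain ⟨s₀, hs₀⟩ := h0
  choose! f hf hrel using hstep
  let F : UpdateHistory → σ := fun h => List.rec s₀ (fun u h s => f h u s) h
  have hF : ∀ h, Inv h (F h) := by
    intro h
    induction h with
    | nil => exact hs₀
    | cons u h ih => exact hf h u _ ih
  exact ⟨F, hF, fun h u => hrel h u _ (hF h)⟩

theorem currentSet_cons_changes (h : UpdateHistory) (u : IntervalUpdate) :
    (∃ X, ∀ J, J ≠ X → (J ∈ currentSet h ↔ J ∈ currentSet (u :: h))) ∧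
      (currentSet h).card ≤ (currentSet (u :: h)).card + 1 ∧
      (currentSet (u :: h)).card ≤ (currentSet h).card + 1 := by
  cases u with
  | insert I =>
    simp only [currentSet, IntervalUpdate.apply]
    refine ⟨⟨I, fun J hJ => by simp [hJ]⟩, ?_, Finset.card_insert_le _ _⟩
    exact (Finset.card_le_card (Finset.subset_insert _ _)).trans (Nat.le_succ _)
  | delete I =>
    simp only [currentSet, IntervalUpdate.apply]
    refine ⟨⟨I, fun J hJ => by simp [hJ]⟩, ?_, ?_⟩
    · have := Finset.pred_card_le_card_erase (s := currentSet h) (a := I)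
      omega
    · exact (Finset.card_le_card (Finset.erase_subset _ _)).trans (Nat.le_succ _)

theorem ColoringStrategy.recolorings_le_card (A : ColoringStrategy) (h : UpdateHistory)
    (u : IntervalUpdate) : A.recolorings h u ≤ (currentSet (u :: h)).card :=
  Finset.card_le_card ((Finset.filter_subset _ _).trans Finset.inter_subset_right)

/-- The potential method. -/
theorem ColoringStrategy.amortized_of_potential {A : ColoringStrategy} {f : ℕ → ℝ}
    (Φ : UpdateHistory → ℝ) (hnil : Φ [] = 0) (hnonneg : ∀ h, 0 ≤ Φ h)
    (hstep : ∀ h u, (A.recolorings h u : ℝ) + Φ (u :: h) ≤ Φ h + f (currentSet (u :: h)).card) :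
    A.AmortizedRecoloringsBoundedBy f := by
  have key : ∀ h, (A.totalRecolorings h : ℝ) + Φ h ≤ sumOverUpdates f h := by
    intro h
    induction h with
    | nil => simp [totalRecolorings, sumOverUpdates, hnil]
    | cons u h ih =>
      have := hstep h u
      rw [totalRecolorings, sumOverUpdates]
      push_cast
      linarith
  intro h
  linarith [key h, hnonneg h]

theorem IsSeparatorChain.eq_empty_of_le {t : ℝ} {S : Finset (NonemptyInterval ℝ)}
    {P : ℕ → Finset ℝ} (hP : IsSeparatorChain t S P) (ht : 2 ≤ t) {M : ℕ}
    (hM : (S.card : ℝ) < t ^ M) (ℓ : ℕ) (hℓ : M ≤ ℓ) : P ℓ = ∅ :=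
  hP.eq_empty (hM.trans_le (pow_le_pow_right₀ (by linarith) hℓ))

theorem logb_natCast_nonneg {t : ℝ} (ht : 2 ≤ t) (n : ℕ) : 0 ≤ Real.logb t n := by
  rcases n.eq_zero_or_pos with rfl | hn
  · simp
  · exact Real.logb_nonneg (by linarith) (by exact_mod_cast hn)

theorem natCast_lt_pow_floor_logb {t : ℝ} (ht : 2 ≤ t) (n : ℕ) :
    (n : ℝ) < t ^ (⌊Real.logb t n⌋₊ + 1) := by
  rcases n.eq_zero_or_pos with rfl | hn
  · simp
    linarith
  · rw [← Real.rpow_natCast, ← Real.logb_lt_iff_lt_rpow (by linarith) (by exact_mod_cast hn)]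
    exact_mod_cast Nat.lt_floor_add_one (Real.logb t n)

theorem exists_worstCase_strategy {t : ℝ} (ht : 2 ≤ t) : ∃ A : ColoringStrategy,
    A.MaintainsConflictFree ∧
    A.ColorsBoundedBy (fun n => 720 * max 1 (Real.logb t n)) ∧
    A.RecoloringsBoundedBy (fun n => 720 * (t * max 1 (Real.logb t n))) := by
  obtain ⟨F, hF, hrel⟩ := exists_online_state
    (fun h P => IsSeparatorChain t (currentSet h) P)
    (fun _ _ P P' => ∀ ℓ, (symmDiff (P ℓ) (P' ℓ)).card ≤ 2)
    ⟨_, isSeparatorChain_empty ht⟩ (fun h u P hP => hP.exists_update ht u)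
  refine ⟨fun h => chainColor (currentSet h) (F h), fun h => (hF h).isConflictFree ht,
    fun h => ?_, fun h u => ?_⟩
  · refine (hF h).usesAtMostColors
      ((hF h).eq_empty_of_le ht (natCast_lt_pow_floor_logb ht (currentSet h).card)) ?_
    have h1 := Nat.floor_le (logb_natCast_nonneg ht (currentSet h).card)
    have h2 := le_max_left 1 (Real.logb t (currentSet h).card)
    have h3 := le_max_right 1 (Real.logb t (currentSet h).card)
    push_cast
    linarith
  · obtain ⟨⟨X, hX⟩, hle, -⟩ := currentSet_cons_changes h u
    set n := (currentSet (u :: h)).card with hn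
    have h2 := le_max_left 1 (Real.logb t n)
    have h3 := le_max_right 1 (Real.logb t n)
    rcases n.eq_zero_or_pos with h0 | hpos
    · have h1 := ColoringStrategy.recolorings_le_card
        (fun h => chainColor (currentSet h) (F h)) h u
      rw [← hn, h0, Nat.le_zero] at h1
      rw [h1]
      push_cast
      have : 0 < t * max 1 (Real.logb t n) := by positivity
      linarith
    have hpow := natCast_lt_pow_floor_logb ht n
    have h1 : (1 : ℝ) ≤ n := by exact_mod_cast hpos
    have hle' : ((currentSet h).card : ℝ) ≤ n + 1 := by exact_mod_cast hle
    -- The set before the update may have `n + 1` elements; one extra level covers this since `n + 1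
    -- ≤ 2 * n ≤ t * n`. The factor 720 is `240 * 3`, as `⌊log_t n⌋ + 2 ≤ 3 * max 1 (log_t n)`.
    have hM : (n : ℝ) + 1 < t ^ (⌊Real.logb t n⌋₊ + 2) := by
      rw [pow_succ]
      nlinarith
    have := (hF h).card_recolored_le (hF (u :: h)) ht hX (hrel h u)
      ((hF h).eq_empty_of_le ht (hle'.trans_lt hM))
      ((hF (u :: h)).eq_empty_of_le ht (by rw [← hn]; linarith))
    have h4 := Nat.floor_le (logb_natCast_nonneg ht n)
    refine le_trans this ?_
    push_cast
    nlinarith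

/-! ### Amortized strategies -/

/-- For `n = 1` the allowance `1 / ε` can be arbitrarily small, so updates among sets of at most one
interval must cost exactly nothing. -/
theorem currentSet_eq_or_inter_eq_empty {h : UpdateHistory} {u : IntervalUpdate}
    (hc : (currentSet h).card ≤ 1) (hc' : (currentSet (u :: h)).card ≤ 1) :
    currentSet h = currentSet (u :: h) ∨ currentSet h ∩ currentSet (u :: h) = ∅ := by
  cases u with
  | insert I =>
    simp only [currentSet, IntervalUpdate.apply] at *
    rcases (currentSet h).eq_empty_or_nonempty with h0 | h0
    · exact Or.inr (by rw [h0, Finset.empty_inter])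
    · refine Or.inl (Finset.eq_of_subset_of_card_le (Finset.subset_insert _ _) ?_)
      exact hc'.trans h0.card_pos
  | delete I =>
    simp only [currentSet, IntervalUpdate.apply] at *
    rcases ((currentSet h).erase I).eq_empty_or_nonempty with h0 | h0
    · exact Or.inr (by rw [h0, Finset.inter_empty])
    · refine Or.inl (Finset.eq_of_subset_of_card_le (Finset.erase_subset _ _) ?_).symm
      exact hc.trans h0.card_pos

/-- For a large exponent, all intervals may be recolored at each update. -/
theorem exists_amortized_strategy_of_one_le {ε : ℝ} (hε : 1 ≤ ε) : ∃ A : ColoringStrategy,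
    A.MaintainsConflictFree ∧ A.ColorsBoundedBy (fun _ => 3) ∧
    A.AmortizedRecoloringsBoundedBy (fun n => 4 * ((n : ℝ) ^ ε / ε)) := by
  refine ⟨fun h => coverColor (currentSet h), fun h => isConflictFree_coverColor _,
    fun h => ⟨3, by norm_num, fun I _ => coverColor_lt _ I⟩,
    ColoringStrategy.amortized_of_potential
      -- One unit is saved while at least two intervals are present. It pays for the possible
      -- recoloring of the last interval when the size drops to one.
      (fun h => if 2 ≤ (currentSet h).card then 1 else 0) (by simp [currentSet])
      (fun h => by split_ifs <;> norm_num) (fun h u => ?_)⟩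
  have hr := ColoringStrategy.recolorings_le_card (fun h => coverColor (currentSet h)) h u
  by_cases h2 : 2 ≤ (currentSet (u :: h)).card
  · set n := (currentSet (u :: h)).card
    rw [if_pos h2]
    have h2' : (2 : ℝ) ≤ n := by exact_mod_cast h2
    have hr' : (ColoringStrategy.recolorings (fun h => coverColor (currentSet h)) h u : ℝ) ≤ n := by
      exact_mod_cast hr
    have e1 : (n : ℝ) ^ ε = ((n : ℝ) / 2) ^ ε * 2 ^ ε := by
      rw [← Real.mul_rpow (by positivity) (by norm_num)]
      congr 1
      ring
    have e2 : (n : ℝ) / 2 ≤ ((n : ℝ) / 2) ^ ε := Real.self_le_rpow_of_one_le (by linarith) hε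
    have e3 : ε ≤ (2 : ℝ) ^ ε := by
      have := one_add_mul_self_le_rpow_one_add (s := 1) (by norm_num) hε
      norm_num at this
      linarith
    have e4 : (n : ℝ) / 2 ≤ (n : ℝ) ^ ε / ε := by
      rw [le_div_iff₀ (by linarith), e1]
      exact mul_le_mul e2 e3 (by linarith) (by positivity)
    have e5 : (0 : ℝ) ≤ if 2 ≤ (currentSet h).card then 1 else 0 := by
      split_ifs <;> norm_num
    linarith
  · rw [if_neg h2]
    have hf : 0 ≤ 4 * (((currentSet (u :: h)).card : ℝ) ^ ε / ε) := by positivity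
    by_cases h3 : 2 ≤ (currentSet h).card
    · rw [if_pos h3]
      have : (ColoringStrategy.recolorings (fun h => coverColor (currentSet h)) h u : ℝ) ≤ 1 := by
        exact_mod_cast hr.trans (by omega)
      linarith
    · rw [if_neg h3]
      have : ColoringStrategy.recolorings (fun h => coverColor (currentSet h)) h u = 0 := by
        rw [ColoringStrategy.recolorings]
        rcases currentSet_eq_or_inter_eq_empty (h := h) (u := u) (by omega) (by omega) with h4 | h4
        · rw [← h4]
          simp
        · rw [h4]
          simp
      rw [this]
      push_cast
      linarith

/-- With `t = max 2 (N ^ ε)`, the power `⌈1 / ε⌉` of `t` already reaches `N`, and two more factors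
of at least 2 absorb the factor 2. So `O(1 / ε)` levels suffice for every set of size up to `2 * N`.
-/
theorem two_mul_natCast_lt_pow {ε : ℝ} (hε : 0 < ε) (N : ℕ) :
    2 * (N : ℝ) < max 2 ((N : ℝ) ^ ε) ^ (⌈1 / ε⌉₊ + 2) := by
  set t := max 2 ((N : ℝ) ^ ε)
  have ht : 2 ≤ t := le_max_left _ _
  have h1 : (N : ℝ) ≤ t ^ ⌈1 / ε⌉₊ := by
    calc (N : ℝ) = ((N : ℝ) ^ ε) ^ (1 / ε) := by
          rw [← Real.rpow_mul (Nat.cast_nonneg _), mul_one_div_cancel hε.ne', Real.rpow_one]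
      _ ≤ t ^ (1 / ε) := Real.rpow_le_rpow (by positivity) (le_max_right _ _) (by positivity)
      _ ≤ t ^ (⌈1 / ε⌉₊ : ℝ) :=
          Real.rpow_le_rpow_of_exponent_le (by linarith) (Nat.le_ceil _)
      _ = t ^ ⌈1 / ε⌉₊ := Real.rpow_natCast _ _
  have h2 : 0 < t ^ ⌈1 / ε⌉₊ := by positivity
  have h3 : 4 ≤ t ^ 2 := by nlinarith
  rw [pow_add]
  nlinarith

/-- For a small exponent, the separators are chosen anew when the number of intervals has changed
by a constant factor. -/
theorem exists_amortized_strategy_of_le_one {ε : ℝ} (hε : 0 < ε) (hε1 : ε ≤ 1) :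
    ∃ A : ColoringStrategy,
    A.MaintainsConflictFree ∧ A.ColorsBoundedBy (fun _ => 9 * (1 / ε)) ∧
    A.AmortizedRecoloringsBoundedBy (fun n => 1922 * ((n : ℝ) ^ ε / ε)) := by
  let t : ℕ → ℝ := fun N => max 2 ((N : ℝ) ^ ε)
  have ht : ∀ N, 2 ≤ t N := fun N => le_max_left _ _
  -- The state is a reference size `N`, which fixes `t`, together with a chain. Both are replaced as
  -- soon as the size is no longer within a factor 2 of `N`.
  obtain ⟨F, hF, hrel⟩ := exists_online_state (σ := ℕ × (ℕ → Finset ℝ))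
    (fun h s => s.1 ≤ 2 * (currentSet h).card ∧ (currentSet h).card ≤ 2 * s.1 ∧
      IsSeparatorChain (t s.1) (currentSet h) s.2)
    (fun h u s s' => (s'.1 = s.1 ∧ ∀ ℓ, (symmDiff (s.2 ℓ) (s'.2 ℓ)).card ≤ 2) ∨
      (s'.1 = (currentSet (u :: h)).card ∧
        (2 * (currentSet (u :: h)).card < s.1 ∨ 2 * s.1 < (currentSet (u :: h)).card)))
    ⟨(0, fun _ => ∅), by simp, by simp [currentSet], isSeparatorChain_empty (ht 0)⟩ (by
      rintro h u ⟨N, P⟩ ⟨-, -, hP⟩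
      by_cases hN : N ≤ 2 * (currentSet (u :: h)).card ∧ (currentSet (u :: h)).card ≤ 2 * N
      · obtain ⟨P', hP', hΔ⟩ := hP.exists_update (ht N) u
        exact ⟨(N, P'), ⟨hN.1, hN.2, hP'⟩, Or.inl ⟨rfl, hΔ⟩⟩
      · obtain ⟨P', hP'⟩ := exists_isSeparatorChain (ht (currentSet (u :: h)).card)
          (currentSet (u :: h))
        exact ⟨((currentSet (u :: h)).card, P'), ⟨by dsimp only; omega, by dsimp only; omega, hP'⟩,
          Or.inr ⟨rfl, by dsimp only; omega⟩⟩)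
  have hpow : ∀ h, ((currentSet h).card : ℝ) < t (F h).1 ^ (⌈1 / ε⌉₊ + 2) := by
    intro h
    have h1 : ((currentSet h).card : ℝ) ≤ 2 * (F h).1 := by exact_mod_cast (hF h).2.1
    exact h1.trans_lt (two_mul_natCast_lt_pow hε _)
  have hempty : ∀ h ℓ, ⌈1 / ε⌉₊ + 2 ≤ ℓ → (F h).2 ℓ = ∅ := fun h =>
    (hF h).2.2.eq_empty_of_le (ht _) (hpow h)
  have hε' : 1 ≤ 1 / ε := (one_le_div hε).2 hε1
  have hM : ((⌈1 / ε⌉₊ + 2 : ℕ) : ℝ) ≤ 4 * (1 / ε) := by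
    have := Nat.ceil_lt_add_one (zero_le_one.trans hε')
    push_cast
    linarith
  refine ⟨fun h => chainColor (currentSet h) (F h).2,
    fun h => (hF h).2.2.isConflictFree (ht _),
    fun h => (hF h).2.2.usesAtMostColors (hempty h) (by linarith),
    ColoringStrategy.amortized_of_potential
      -- The potential grows by at most 2 per update between rebuilds, which explains `1922 = 1920 +
      -- 2`.
      (fun h => 2 * |((currentSet h).card : ℝ) - (F h).1|) ?_ (fun h => by positivity)
      fun h u => ?_⟩
  · have h1 := (hF []).1
    have h2 : (F []).1 = 0 := by simpa [currentSet] using h1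
    simp [h2, currentSet]
  set A : ColoringStrategy := fun h => chainColor (currentSet h) (F h).2
  have hr := ColoringStrategy.recolorings_le_card A h u
  obtain ⟨⟨X, hX⟩, hle, hle'⟩ := currentSet_cons_changes h u
  have hrec : (∀ ℓ, (symmDiff ((F h).2 ℓ) ((F (u :: h)).2 ℓ)).card ≤ 2) →
      (F (u :: h)).1 = (F h).1 →
      (A.recolorings h u : ℝ) ≤ 240 * t (F h).1 * ((⌈1 / ε⌉₊ + 2 : ℕ) : ℝ) := by
    intro hΔ hN
    have hchain := (hF (u :: h)).2.2
    rw [hN] at hchain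
    exact (hF h).2.2.card_recolored_le hchain (ht _) hX hΔ (hempty h) (hempty (u :: h))
  have hNn := (hF (u :: h)).1
  have hNn' := (hF (u :: h)).2.1
  have hstep := hrel h u
  generalize (currentSet (u :: h)).card = n' at *
  generalize (currentSet h).card = n at *
  generalize (F (u :: h)).1 = N' at *
  generalize (F h).1 = N at *
  have hdiff : |(n' : ℝ) - N| ≤ |(n : ℝ) - N| + 1 ∧ |(n' : ℝ) - N| - 1 ≤ |(n : ℝ) - N| := by
    have h1 : (n : ℝ) ≤ n' + 1 := by exact_mod_cast hle
    have h2 : (n' : ℝ) ≤ n + 1 := by exact_mod_cast hle'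
    have h3 : |(n' : ℝ) - n| ≤ 1 := abs_le.2 ⟨by linarith, by linarith⟩
    have h4 := abs_sub_le (n' : ℝ) n N
    constructor <;> linarith
  have hr' : (A.recolorings h u : ℝ) ≤ n' := by exact_mod_cast hr
  rcases n'.eq_zero_or_pos with rfl | hpos
  · have h1 : N' = 0 := by omega
    subst h1
    have h2 : (0 : ℝ) ≤ ((0 : ℕ) : ℝ) ^ ε / ε := by positivity
    have h3 := abs_nonneg ((n : ℝ) - N)
    simp only [Nat.cast_zero, sub_zero, abs_zero] at *
    linarith
  have h1 : (1 : ℝ) ≤ n' := by exact_mod_cast hpos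
  have hnε : 1 ≤ (n' : ℝ) ^ ε := Real.one_le_rpow h1 hε.le
  have hf : 1 ≤ (n' : ℝ) ^ ε / ε := by
    rw [le_div_iff₀ hε]
    linarith
  rcases hstep with ⟨rfl, hΔ⟩ | ⟨rfl, hN⟩
  · have hNr : (N' : ℝ) ≤ 2 * n' := by exact_mod_cast hNn
    have ht' : t N' ≤ 2 * (n' : ℝ) ^ ε := by
      refine max_le (by linarith) ?_
      calc (N' : ℝ) ^ ε ≤ (2 * (n' : ℝ)) ^ ε :=
            Real.rpow_le_rpow (Nat.cast_nonneg _) hNr hε.le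
        _ = 2 ^ ε * (n' : ℝ) ^ ε := Real.mul_rpow (by norm_num) (by linarith)
        _ ≤ 2 * (n' : ℝ) ^ ε := by
            refine mul_le_mul_of_nonneg_right ?_ (by linarith)
            simpa using Real.rpow_le_rpow_of_exponent_le (x := 2) (by norm_num) hε1
    have h2 := hrec hΔ rfl
    have h3 : 240 * t N' * ((⌈1 / ε⌉₊ + 2 : ℕ) : ℝ) ≤
        240 * (2 * (n' : ℝ) ^ ε) * (4 * (1 / ε)) := by
      gcongr
    have h4 : 240 * (2 * (n' : ℝ) ^ ε) * (4 * (1 / ε)) = 1920 * ((n' : ℝ) ^ ε / ε) := by ring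
    linarith [hdiff.1]
  -- At a rebuild the old reference size is off by more than a factor 2, so it differs from the new
  -- size by at least half of the latter. The released potential pays for recoloring everything, up
  -- to the additive 2 due to the last update.
  · have h2 : (N' : ℝ) ≤ 2 * |(N' : ℝ) - N| := by
      rcases hN with hN | hN
      · have h3 : 2 * (N' : ℝ) < N := by exact_mod_cast hN
        linarith [neg_abs_le ((N' : ℝ) - N)]
      · have h3 : 2 * (N : ℝ) < N' := by exact_mod_cast hN
        linarith [le_abs_self ((N' : ℝ) - N)]
    rw [sub_self, abs_zero]
    linarith [hdiff.2]

theorem theorem5 :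
    (∃ C : ℝ, 0 < C ∧ ∀ t : ℝ, 2 ≤ t → ∃ A : ColoringStrategy,
      A.MaintainsConflictFree ∧
      A.ColorsBoundedBy (fun n => C * max 1 (Real.logb t n)) ∧
      A.RecoloringsBoundedBy (fun n => C * (t * max 1 (Real.logb t n)))) ∧
    (∃ C : ℝ, 0 < C ∧ ∃ A : ColoringStrategy,
      A.MaintainsConflictFree ∧
      A.ColorsBoundedBy (fun n => C * max 1 (Real.log n)) ∧
      A.RecoloringsBoundedBy (fun n => C * max 1 (Real.log n))) ∧
    (∃ C : ℝ, 0 < C ∧ ∀ ε : ℝ, 0 < ε → ∃ A : ColoringStrategy,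
      A.MaintainsConflictFree ∧
      A.ColorsBoundedBy (fun _ => C * max 1 (1 / ε)) ∧
      A.AmortizedRecoloringsBoundedBy (fun n => C * ((n : ℝ) ^ ε / ε))) := by
  refine ⟨⟨720, by norm_num, fun t ht => exists_worstCase_strategy ht⟩, ?_, ?_⟩
  · obtain ⟨A, hA, hcol, hrec⟩ := exists_worstCase_strategy (le_refl (2 : ℝ))
    -- Passing from base 2 to the natural logarithm costs `1 / log 2 < 2`. With `t = 2` the
    -- recoloring bound becomes `720 * 2 * 2 = 2880`.
    have hlog : ∀ n : ℕ, max 1 (Real.logb 2 n) ≤ 2 * max 1 (Real.log n) := by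
      intro n
      have h1 := le_max_left 1 (Real.log n)
      have h2 := le_max_right 1 (Real.log n)
      refine max_le (by linarith) ?_
      have h3 := Real.log_two_gt_d9
      rw [Real.logb, div_le_iff₀ (by linarith)]
      nlinarith
    refine ⟨2880, by norm_num, A, hA, fun h => ?_, fun h u => ?_⟩
    · obtain ⟨k, hk, hc⟩ := hcol h
      have h1 := hlog (currentSet h).card
      exact ⟨k, by linarith [le_max_left 1 (Real.log (currentSet h).card)], hc⟩
    · have h1 := hlog (currentSet (u :: h)).card
      have h2 := hrec h u
      linarith
  · refine ⟨1922, by norm_num, fun ε hε => ?_⟩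
    rcases le_total ε 1 with h | h
    · obtain ⟨A, hA, hcol, hrec⟩ := exists_amortized_strategy_of_le_one hε h
      refine ⟨A, hA, fun h => ?_, hrec⟩
      obtain ⟨k, hk, hc⟩ := hcol h
      have h1 := le_max_left 1 (1 / ε)
      have h2 := le_max_right 1 (1 / ε)
      exact ⟨k, by linarith, hc⟩
    · obtain ⟨A, hA, hcol, hrec⟩ := exists_amortized_strategy_of_one_le h
      refine ⟨A, hA, fun h => ?_, fun h => (hrec h).trans ?_⟩
      · obtain ⟨k, hk, hc⟩ := hcol h
        have h1 := le_max_left 1 (1 / ε)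
        exact ⟨k, by linarith, hc⟩
      · induction h with
        | nil => exact le_rfl
        | cons u h ih =>
          rw [sumOverUpdates, sumOverUpdates]
          have : 0 ≤ ((currentSet (u :: h)).card : ℝ) ^ ε / ε := by positivity
          linarith
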